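/- Let $\mathcal N$ and $\mathcal Q$ be finite sets. The Hamming graph $H(\mathcal N,\mathcal Q)$ has as vertices all functions $\mathcal N\to\mathcal Q$, two being adjacent if and only if they differ in exactly one entry. For a code (a set of vertices) $\mathcal C$, let $\mathcal C_i$ be the set of vertices at distance $i$ from some element of $\mathcal C$ and at distance $j$ from no element of $\mathcal C$ for all $j<i$; the covering radius of $\mathcal C$ is the largest $i$ with $\mathcal C_i\neq\emptyset$, and $\mathrm{Aut}(\mathcal C)$ is the setwise stabiliser of $\mathcal C$ in the automorphism group of $H(\mathcal N,\mathcal Q)$. The code $\mathcal C$ is $2$-neighbour-transitive if its covering radius is at least $2$ and $\mathrm{Aut}(\mathcal C)$ acts transitively on each of $\mathcal C$, $\mathcal C_1$ and $\mathcal C_2$. Let $q$ be a prime power, let $s\geq 1$, $t\geq 0$ and $\ell\geq 0$ be integers, and let $k$ be an integer with $0<k\leq q-1$. Let $N(a)=a^{(q^s-1)/(q-1)}$ be the norm from $\mathbb F_{q^s}$ to $\mathbb F_q$, and let $R(q,s,t,k)$ be the set of all polynomials $f\in\mathbb F_{q^s}[x_1,\ldots,x_t]$ such that $f(v)\in\mathbb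 F_q$ for all $v\in\mathbb F_{q^s}^t$ and $f(ax_1,\ldots,ax_t)=N(a)^kf(x_1,\ldots,x_t)$ for every $a\in\mathbb F_{q^s}$. Regarding polynomials as functions, define the following codes. - $\mathcal{RM}_q(\ell,t)$, in $H(\mathbb F_q^t,\mathbb F_q)$, consists of the functions given by all polynomials in $\mathbb F_q[x_1,\ldots,x_t]$ of degree at most $\ell$. - $\mathcal{RM}_{q^s/q}(\ell,t)$, in $H(\mathbb F_{q^s}^t,\mathbb F_q)$, consists of the elements of $\mathcal{RM}_{q^s}(\ell,t)$ all of whose values lie in $\mathbb F_q$. - $\mathcal{PRM}_{q^s/q}(\ell,t)$, in $H(\mathcal N,\mathbb F_q)$, where $\mathcal N$ is any set of representatives for the $1$-dimensional subspaces of $\mathbb F_{q^s}^t$, consists of the functions on $\mathcal N$ given by the polynomials in $R(q,s,t,k)$ of degree at most $\ell$. - $\mathcal{PRM}_q(\ell,t)$ is the case $s=1$ of the previous code. Then each of the following codes is $2$-neighbour-transitive: 1. $\mathcal{RM}_2(\ell,t)$ with $\ell\leq t-2$; 2. $\mathcal{RM}_{2^s/2}(\ell,t)$ with $\ell\leq (t-1)(2^s-1)-1$;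 3. $\mathcal{PRM}_q(\ell,t)$ with $\ell\leq (t-1)(q-1)-2$ and $\gcd(k,q-1)=1$; 4. $\mathcal{PRM}_{q^s/q}(\ell,t)$ with $\ell\leq (t-1)(q^s-1)-2$ and $\gcd(k,q-1)=1$. -/

import Mathlib

namespace NTCodes

/-- The Hamming graph `H(N, Q)`: the vertices are the functions `N → Q`, and two of them are
adjacent when they differ in precisely one entry. -/
def hammingGraph (N Q : Type*) : SimpleGraph (N → Q) where
  Adj α β := ∃! i, α i ≠ β i
  symm := ⟨fun _ _ ⟨i, hi, hu⟩ => ⟨i, hi.symm, fun j hj => hu j hj.symm⟩⟩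
  loopless := ⟨fun _ ⟨_, hi, _⟩ => hi rfl⟩

section Codes

variable {N Q : Type*}

/-- `Aut(C)`: the setwise stabiliser of the code `C` in the full automorphism group of the
Hamming graph. -/
def codeAut (C : Set (N → Q)) : Subgroup (hammingGraph N Q ≃g hammingGraph N Q) where
  carrier := {g | ∀ α, g α ∈ C ↔ α ∈ C}
  one_mem' := fun _ => Iff.rfl
  mul_mem' := fun {g h} hg hh α => (hg (h α)).trans (hh α)
  inv_mem' := fun {g} hg α => by
    have h := hg (g⁻¹ α)
    rw [← RelIso.mul_apply, mul_inv_cancel] at h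
    exact h.symm

/-- `C_i`: the vertices at distance `i` from some codeword, and at distance `j` from no codeword
for each `j < i`. -/
def distSet (C : Set (N → Q)) (i : ℕ) : Set (N → Q) :=
  {α | (∃ β ∈ C, (hammingGraph N Q).dist α β = i) ∧
    ∀ j < i, ∀ β ∈ C, (hammingGraph N Q).dist α β ≠ j}

/-- The covering radius of `C` is the largest `i` for which `C_i` is non-empty. -/
def IsCoveringRadius (C : Set (N → Q)) (ρ : ℕ) : Prop :=
  IsGreatest {i | (distSet C i).Nonempty} ρ

/-- The group `G` acts transitively on the set `S` of vertices. -/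
def ActsTransitivelyOn (G : Subgroup (hammingGraph N Q ≃g hammingGraph N Q))
    (S : Set (N → Q)) : Prop :=
  (∀ g ∈ G, ∀ α ∈ S, g α ∈ S) ∧ ∀ α ∈ S, ∀ β ∈ S, ∃ g ∈ G, g α = β

/-- `C` is `(G, r)`-neighbour-transitive: `G ≤ Aut(C)`, `1 ≤ r ≤ ρ` where `ρ` is the covering
radius, and `G` is transitive on each of `C, C_1, …, C_r`. -/
def IsGNeighbourTransitive (G : Subgroup (hammingGraph N Q ≃g hammingGraph N Q))
    (r : ℕ) (C : Set (N → Q)) : Prop :=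
  G ≤ codeAut C ∧ 1 ≤ r ∧ (∃ ρ, IsCoveringRadius C ρ ∧ r ≤ ρ) ∧
    ActsTransitivelyOn G C ∧ ∀ i, 1 ≤ i → i ≤ r → ActsTransitivelyOn G (distSet C i)

/-- `C` is `r`-neighbour-transitive. -/
def IsNeighbourTransitive (r : ℕ) (C : Set (N → Q)) : Prop :=
  IsGNeighbourTransitive (codeAut C) r C

end Codes

section ReedMuller

open MvPolynomial

/-- `R(q, s, t, k)`, where `F`, `E` are the fields of orders `q`, `q ^ s`: the polynomials
`f ∈ E[x_1, …, x_t]` all of whose values lie in `F` and which satisfy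
`f(a x_1, …, a x_t) = N(a)^k f(x_1, …, x_t)` for each `a ∈ E`, where `N` is the norm of `E`
over `F`. -/
noncomputable def polyR (F E : Type*) [Field F] [Field E] [Algebra F E] (t k : ℕ) :
    Submodule F (MvPolynomial (Fin t) E) where
  carrier := {f | (∀ v : Fin t → E, eval v f ∈ Set.range (algebraMap F E)) ∧
    ∀ a : E, aeval (fun i => C a * X i) f = C (algebraMap F E (Algebra.norm F a) ^ k) * f}
  zero_mem' := ⟨fun _ => ⟨0, by simp⟩, fun _ => by simp⟩
  add_mem' := fun {f g} hf hg =>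
    ⟨fun v => by
      obtain ⟨x, hx⟩ := hf.1 v
      obtain ⟨y, hy⟩ := hg.1 v
      exact ⟨x + y, by simp [hx, hy]⟩,
     fun a => by rw [map_add, hf.2 a, hg.2 a, mul_add]⟩
  smul_mem' := fun b f hf =>
    ⟨fun v => by
      obtain ⟨x, hx⟩ := hf.1 v
      refine ⟨b * x, ?_⟩
      rw [← algebraMap_smul E b f, smul_eval, map_mul, hx],
     fun a => by
      rw [← algebraMap_smul E b f, map_smul, hf.2 a, mul_smul_comm]⟩

/-- The generalised Reed–Muller code `RM_q(ℓ, t)` in `H(F^t, F)`, where `F` has order `q`: the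
functions given by the polynomials in `F[x_1, …, x_t]` of degree at most `ℓ`. -/
noncomputable def RM (F : Type*) [Field F] (ℓ t : ℕ) : Submodule F ((Fin t → F) → F) where
  carrier := {c | ∃ f : MvPolynomial (Fin t) F, f.totalDegree ≤ ℓ ∧ ∀ v, c v = eval v f}
  zero_mem' := ⟨0, by simp, by simp⟩
  add_mem' := fun {c d} ⟨f, hf, hc⟩ ⟨g, hg, hd⟩ =>
    ⟨f + g, (totalDegree_add f g).trans (max_le hf hg), fun v => by simp [hc v, hd v]⟩
  smul_mem' := fun b c ⟨f, hf, hc⟩ =>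
    ⟨b • f, (totalDegree_smul_le b f).trans hf, fun v => by simp [hc v]⟩

/-- The subfield subcode `RM_{q^s/q}(ℓ, t)` in `H(E^t, F)`, where `F`, `E` have orders `q`,
`q ^ s`: the codewords of `RM_{q^s}(ℓ, t)` all of whose entries lie in `F`. -/
noncomputable def subfieldRM (F E : Type*) [Field F] [Field E] [Algebra F E] (ℓ t : ℕ) :
    Submodule F ((Fin t → E) → F) where
  carrier := {c | (fun v => algebraMap F E (c v)) ∈ RM E ℓ t}
  zero_mem' := by
    have h := (RM E ℓ t).zero_mem
    simpa [Pi.zero_def] using h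
  add_mem' := fun {c d} hc hd => by
    have h := (RM E ℓ t).add_mem hc hd
    simpa [Pi.add_def] using h
  smul_mem' := fun b c hc => by
    have h := (RM E ℓ t).smul_mem (algebraMap F E b) hc
    have e : (fun v => algebraMap F E ((b • c) v)) =
        algebraMap F E b • fun v => algebraMap F E (c v) := by
      funext v
      simp only [Pi.smul_apply, smul_eq_mul, map_mul]
    rw [Set.mem_ofPred_eq, e]
    exact h

/-- `S` is a set of representatives for the set of all `1`-dimensional subspaces of `E^t`. -/
def IsProjectiveReps {E : Type*} [Field E] {t : ℕ} (S : Set (Fin t → E)) : Prop :=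
  Set.BijOn (fun v => Submodule.span E {v}) S
    {W : Submodule E (Fin t → E) | Module.finrank E W = 1}

/-- The code `PRM_{q^s/q}(ℓ, t)` in `H(S, F)`, where `F`, `E` have orders `q`, `q ^ s`: the
functions on `S ⊆ E^t` given by the polynomials in `R(q, s, t, k)` of degree at most `ℓ`. -/
noncomputable def subfieldPRM (F E : Type*) [Field F] [Field E] [Algebra F E] (k ℓ t : ℕ)
    (S : Set (Fin t → E)) : Submodule F (S → F) where
  carrier := {c | ∃ f ∈ polyR F E t k, f.totalDegree ≤ ℓ ∧
    ∀ v : S, algebraMap F E (c v) = eval (v : Fin t → E) f}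
  zero_mem' := ⟨0, Submodule.zero_mem _, by simp, by simp⟩
  add_mem' := fun {c d} ⟨f, hfR, hf, hc⟩ ⟨g, hgR, hg, hd⟩ =>
    ⟨f + g, Submodule.add_mem _ hfR hgR, (totalDegree_add f g).trans (max_le hf hg),
      fun v => by simp [hc v, hd v]⟩
  smul_mem' := fun b c ⟨f, hfR, hf, hc⟩ =>
    ⟨b • f, Submodule.smul_mem _ b hfR, (totalDegree_smul_le b f).trans hf, fun v => by
      rw [← algebraMap_smul E b f, smul_eval, ← hc v]
      simp⟩

/-- The projective Reed–Muller code `PRM_q(ℓ, t)` in `H(S, F)`, where `F` has order `q`: the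
case `s = 1`, so the functions given by the polynomials in `R(q, 1, t, k)` of degree at
most `ℓ`. -/
noncomputable def PRM (F : Type*) [Field F] (k ℓ t : ℕ) (S : Set (Fin t → F)) :
    Submodule F (S → F) :=
  subfieldPRM F F k ℓ t S

end ReedMuller

end NTCodes

/-!
Each of the codes is linear, so translations by codewords reduce `2`-neighbour-transitivity to two
facts: every nonzero codeword has weight at least `4`, and `Aut(C)` is transitive on the vectors of
weight `1` and on those of weight `2`. In the affine case `AGL_t(E)` is `2`-transitive on the points
and `F` has only one nonzero scalar. In the projective case `GL_t(E)` moves two points to any two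
others with arbitrary independent scalars, and these act on the code through `a ↦ N(a)^k`, which is
onto `Fˣ` because `k` is prime to `q - 1`.

The weight bounds come from a single observation: the values of a polynomial in `t` variables of
degree less than `t(|E| - 1)` sum to zero, so such a polynomial cannot be nonzero at exactly one
point. A codeword of small weight would contradict this after being multiplied by a product of
linear polynomials that vanish on all of its support except one point. For the projective codes
the support consists of punctured lines, and `|E| - 2` further factors remove all but one point of
the remaining line. Over the field of two elements the sum also shows that affine weights are even.
-/

namespace NTCodes

section Distance

theorem dist_map_iso {V W : Type*} {G : SimpleGraph V} {H : SimpleGraph W} (e : G ≃g H) (u v : V) :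
    H.dist (e u) (e v) = G.dist u v := by
  by_cases huv : G.Reachable u v
  · obtain ⟨p, hp⟩ := huv.exists_walk_length_eq_dist
    obtain ⟨p', hp'⟩ := (e.reachable_iff.2 huv).exists_walk_length_eq_dist
    refine le_antisymm ?_ ?_
    · rw [← hp, ← p.length_map e.toHom]
      exact SimpleGraph.dist_le _
    · rw [← hp', ← p'.length_map e.symm.toHom]
      simpa using SimpleGraph.dist_le (p'.map e.symm.toHom)
  · rw [SimpleGraph.dist_eq_zero_of_not_reachable huv,
      SimpleGraph.dist_eq_zero_of_not_reachable (mt e.reachable_iff.1 huv)]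

variable {N Q : Type*}

section HammingDist

variable [Fintype N] [DecidableEq Q]

theorem hammingGraph_adj_iff_hammingDist_eq_one {α β : N → Q} :
    (hammingGraph N Q).Adj α β ↔ hammingDist α β = 1 := by
  simp only [hammingGraph, hammingDist, Finset.card_eq_one, Finset.ext_iff, Finset.mem_filter,
    Finset.mem_univ, true_and, Finset.mem_singleton]
  exact exists_congr fun i => ⟨fun ⟨hi, hu⟩ j => ⟨hu j, fun h => h ▸ hi⟩,
    fun h => ⟨(h i).2 rfl, fun j => (h j).1⟩⟩

theorem hammingDist_le_length {α β : N → Q} (w : (hammingGraph N Q).Walk α β) :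
    hammingDist α β ≤ w.length := by
  induction w with
  | nil => simp
  | @cons a b c h p ih =>
    have hab := hammingGraph_adj_iff_hammingDist_eq_one.1 h
    have htri := hammingDist_triangle a b c
    rw [SimpleGraph.Walk.length_cons]
    omega

theorem hammingDist_update_add_one [DecidableEq N] {α β : N → Q} {i : N} (hi : α i ≠ β i) :
    hammingDist (Function.update α i (β i)) β + 1 = hammingDist α β := by
  have herase : (Finset.univ.filter fun j => Function.update α i (β i) j ≠ β j) =
      (Finset.univ.filter fun j => α j ≠ β j).erase i := by
    ext j
    rcases eq_or_ne j i with rfl | hj <;> simp [*]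
  rw [hammingDist, hammingDist, herase, Finset.card_erase_add_one (by simpa using hi)]

theorem exists_walk_length_eq_hammingDist (α β : N → Q) :
    ∃ w : (hammingGraph N Q).Walk α β, w.length = hammingDist α β := by
  classical
  induction hn : hammingDist α β generalizing α with
  | zero =>
    obtain rfl := hammingDist_eq_zero.1 hn
    exact ⟨.nil, rfl⟩
  | succ n ih =>
    have hne : α ≠ β := hammingDist_pos.1 (by omega)
    obtain ⟨i, hi⟩ := Function.ne_iff.1 hne
    have hadj : (hammingGraph N Q).Adj α (Function.update α i (β i)) := by
      refine ⟨i, by simpa using hi, fun j hj => ?_⟩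
      by_contra hji
      exact hj (by simp [hji])
    obtain ⟨w, hw⟩ := ih _ (Nat.succ_injective ((hammingDist_update_add_one hi).trans hn))
    exact ⟨.cons hadj w, by simp [hw]⟩

theorem dist_hammingGraph (α β : N → Q) : (hammingGraph N Q).dist α β = hammingDist α β := by
  obtain ⟨w, hw⟩ := exists_walk_length_eq_hammingDist α β
  obtain ⟨w', hw'⟩ := w.reachable.exists_walk_length_eq_dist
  exact le_antisymm (hw ▸ SimpleGraph.dist_le w) (hw' ▸ hammingDist_le_length w')

end HammingDist

variable {C : Set (N → Q)}

theorem map_mem_distSet {g : hammingGraph N Q ≃g hammingGraph N Q} (hg : g ∈ codeAut C) {i : ℕ}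
    {α : N → Q} (hα : α ∈ distSet C i) : g α ∈ distSet C i := by
  obtain ⟨⟨β, hβ, hd⟩, hmin⟩ := hα
  refine ⟨⟨g β, (hg β).2 hβ, by rw [dist_map_iso, hd]⟩, fun j hj γ hγ => ?_⟩
  have hγ' : g.symm γ ∈ C := by
    rw [← hg]
    simpa using hγ
  have hne := hmin j hj _ hγ'
  rwa [← dist_map_iso g, RelIso.apply_symm_apply] at hne

theorem mem_codeAut_of_forall_mem [Finite N] [Finite Q]
    {g : hammingGraph N Q ≃g hammingGraph N Q} (hg : ∀ α ∈ C, g α ∈ C) : g ∈ codeAut C := by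
  intro α
  refine ⟨fun h => ?_, hg α⟩
  have himage : g '' C = C :=
    Set.eq_of_subset_of_ncard_le (Set.image_subset_iff.2 hg)
      (Set.ncard_image_of_injective C g.injective).ge (Set.toFinite C)
  rw [← himage] at h
  exact g.injective.mem_set_image.1 h

theorem exists_isCoveringRadius_ge [Finite N] {i : ℕ} (hi : (distSet C i).Nonempty) :
    ∃ ρ, IsCoveringRadius C ρ ∧ i ≤ ρ := by
  classical
  have := Fintype.ofFinite N
  have hbdd : BddAbove {i | (distSet C i).Nonempty} := by
    refine ⟨Fintype.card N, ?_⟩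
    rintro i ⟨α, ⟨β, -, rfl⟩, -⟩
    rw [dist_hammingGraph]
    exact hammingDist_le_card_fintype
  exact ⟨_, ⟨Nat.sSup_mem ⟨i, hi⟩ hbdd, fun j hj => le_csSup hbdd hj⟩, le_csSup hbdd hi⟩

end Distance

section AdditiveCodes

variable {N Q : Type*} [AddGroup Q]

/-- Translation by `c`, as an automorphism of the Hamming graph. -/
def translation (c : N → Q) : hammingGraph N Q ≃g hammingGraph N Q where
  toEquiv := Equiv.addLeft c
  map_rel_iff' := by simp [hammingGraph]

@[simp]
theorem translation_apply (c α : N → Q) : translation c α = c + α := rfl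

theorem translation_mem_codeAut (C : AddSubgroup (N → Q)) {c : N → Q} (hc : c ∈ C) :
    translation c ∈ codeAut (C : Set (N → Q)) := fun _ => C.add_mem_cancel_left hc

theorem actsTransitivelyOn_codeAut (C : AddSubgroup (N → Q)) :
    ActsTransitivelyOn (codeAut (C : Set (N → Q))) (C : Set (N → Q)) :=
  ⟨fun _ hg α hα => (hg α).2 hα, fun α hα β hβ =>
    ⟨translation (β - α), translation_mem_codeAut C (C.sub_mem hβ hα), by simp⟩⟩

variable [Fintype N] [DecidableEq Q]

theorem exists_hammingNorm_eq [Nontrivial Q] {r : ℕ} (hr : r ≤ Fintype.card N) :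
    ∃ w : N → Q, hammingNorm w = r := by
  classical
  obtain ⟨T, -, hT⟩ := Finset.exists_subset_card_eq (s := (Finset.univ : Finset N)) hr
  obtain ⟨a, ha⟩ := exists_ne (0 : Q)
  refine ⟨fun n => if n ∈ T then a else 0, ?_⟩
  simp [hammingNorm, ha, hT]

theorem mem_distSet_of_hammingNorm_eq {C : AddSubgroup (N → Q)} {i : ℕ}
    (hC : ∀ c ∈ C, c ≠ 0 → 2 * i ≤ hammingNorm c) {w : N → Q} (hw : hammingNorm w = i) :
    w ∈ distSet (C : Set (N → Q)) i := by
  refine ⟨⟨0, C.zero_mem, by rw [dist_hammingGraph, hammingDist_zero_right, hw]⟩,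
    fun j hj β hβ hd => ?_⟩
  rw [dist_hammingGraph] at hd
  rcases eq_or_ne β 0 with rfl | hβ0
  · rw [hammingDist_zero_right] at hd
    omega
  · have hmin := hC β hβ hβ0
    have htri := hammingDist_triangle_left β 0 w
    rw [hammingDist_zero_right, hammingDist_zero_right] at htri
    omega

theorem actsTransitivelyOn_distSet {C : AddSubgroup (N → Q)} {i : ℕ}
    (h : ∀ w w' : N → Q, hammingNorm w = i → hammingNorm w' = i →
      ∃ g ∈ codeAut (C : Set (N → Q)), g w = w') :
    ActsTransitivelyOn (codeAut (C : Set (N → Q))) (distSet (C : Set (N → Q)) i) := by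
  refine ⟨fun g hg α hα => map_mem_distSet hg hα, ?_⟩
  rintro α ⟨⟨β, hβ, hd⟩, -⟩ α' ⟨⟨β', hβ', hd'⟩, -⟩
  rw [dist_hammingGraph, hammingDist_comm, hammingDist_eq_hammingNorm] at hd hd'
  obtain ⟨g, hg, hgw⟩ := h _ _ hd hd'
  have hmem := mul_mem (mul_mem (translation_mem_codeAut C hβ') hg)
    (translation_mem_codeAut C (C.neg_mem hβ))
  refine ⟨translation β' * g * translation (-β), hmem, ?_⟩
  simp [RelIso.mul_apply, hgw]

theorem isNeighbourTransitive_of_two_mul_le_hammingNorm [Nontrivial Q] {C : AddSubgroup (N → Q)}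
    {r : ℕ} (hr : 1 ≤ r) (hrN : r ≤ Fintype.card N)
    (hmin : ∀ c ∈ C, c ≠ 0 → 2 * r ≤ hammingNorm c)
    (htrans : ∀ i ≤ r, ∀ w w' : N → Q, hammingNorm w = i → hammingNorm w' = i →
      ∃ g ∈ codeAut (C : Set (N → Q)), g w = w') :
    IsNeighbourTransitive r (C : Set (N → Q)) := by
  obtain ⟨w, hw⟩ := exists_hammingNorm_eq (Q := Q) hrN
  exact ⟨le_rfl, hr, exists_isCoveringRadius_ge ⟨w, mem_distSet_of_hammingNorm_eq hmin hw⟩,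
    actsTransitivelyOn_codeAut C, fun i _ hi => actsTransitivelyOn_distSet (htrans i hi)⟩

end AdditiveCodes

section MonomialMaps

variable {N F : Type*}

/-- The monomial map `α ↦ (n ↦ u n * α (σ n))`, as an automorphism of the Hamming graph. -/
def monomialMap [Monoid F] (σ : Equiv.Perm N) (u : N → Fˣ) :
    hammingGraph N F ≃g hammingGraph N F where
  toFun α n := u n * α (σ n)
  invFun α m := ↑(u (σ.symm m))⁻¹ * α (σ.symm m)
  left_inv α := by ext; simp
  right_inv α := by ext; simp
  map_rel_iff' := by
    intro a b
    simp only [hammingGraph, Equiv.coe_fn_mk, ne_eq, Units.mul_right_inj]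
    exact σ.existsUnique_congr fun _ => Iff.rfl

@[simp]
theorem monomialMap_apply [Monoid F] (σ : Equiv.Perm N) (u : N → Fˣ) (α : N → F) (n : N) :
    monomialMap σ u α n = u n * α (σ n) := rfl

/-- The monomial automorphisms of the code `C` take any `r` distinct coordinates, in order, to any
other `r`, with arbitrary prescribed scalars there. As `monomialMap` substitutes `σ`, the coordinate
`x i` is taken to `y i` when `σ (y i) = x i`. -/
def MonomiallyTransitive [Monoid F] (r : ℕ) (C : Set (N → F)) : Prop :=
  ∀ (x y : Fin r ↪ N) (a : Fin r → Fˣ), ∃ (σ : Equiv.Perm N) (u : N → Fˣ),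
    monomialMap σ u ∈ codeAut C ∧ ∀ i, σ (y i) = x i ∧ u (y i) = a i

theorem MonomiallyTransitive.mono [Monoid F] [Finite N] {C : Set (N → F)} {i r : ℕ}
    (hC : MonomiallyTransitive r C) (hir : i ≤ r) (hr : r ≤ Nat.card N) :
    MonomiallyTransitive i C := by
  intro x y a
  obtain ⟨x', rfl⟩ := Fin.Embedding.restrictSurjective_of_le_natCard hir hr x
  obtain ⟨y', rfl⟩ := Fin.Embedding.restrictSurjective_of_le_natCard hir hr y
  obtain ⟨σ, u, hmem, h⟩ := hC x' y' fun j => if hj : j < i then a ⟨j, hj⟩ else 1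
  exact ⟨σ, u, hmem, fun j => by simpa using h (Fin.castLE hir j)⟩

theorem exists_embedding_range_eq_support [Zero F] [DecidableEq F] [Fintype N] {w : N → F} {r : ℕ}
    (hw : hammingNorm w = r) : ∃ x : Fin r ↪ N, Set.range x = Function.support w := by
  refine ⟨(Finset.equivFinOfCardEq hw).symm.toEmbedding.trans (Function.Embedding.subtype _), ?_⟩
  rw [Function.Embedding.coe_trans, Equiv.coe_toEmbedding, EquivLike.range_comp]
  ext n
  simp

theorem MonomiallyTransitive.exists_mem_codeAut_apply_eq [GroupWithZero F] [DecidableEq F]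
    [Fintype N] {C : Set (N → F)} {r : ℕ} (hC : MonomiallyTransitive r C) {w w' : N → F}
    (hw : hammingNorm w = r) (hw' : hammingNorm w' = r) : ∃ g ∈ codeAut C, g w = w' := by
  obtain ⟨x, hx⟩ := exists_embedding_range_eq_support hw
  obtain ⟨y, hy⟩ := exists_embedding_range_eq_support hw'
  have hwx (i) : w (x i) ≠ 0 := Function.mem_support.1 (hx ▸ Set.mem_range_self i)
  have hwy (i) : w' (y i) ≠ 0 := Function.mem_support.1 (hy ▸ Set.mem_range_self i)
  obtain ⟨σ, u, hmem, h⟩ := hC x y fun i => Units.mk0 _ (hwy i) * (Units.mk0 _ (hwx i))⁻¹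
  refine ⟨monomialMap σ u, hmem, funext fun n => ?_⟩
  rw [monomialMap_apply]
  by_cases hn : n ∈ Set.range y
  · obtain ⟨i, rfl⟩ := hn
    simp [h i, hwx i]
  · have hσn : σ n ∉ Set.range x := by
      rintro ⟨i, hi⟩
      exact hn ⟨i, σ.injective ((h i).1.trans hi)⟩
    rw [hx, Function.notMem_support] at hσn
    rw [hy, Function.notMem_support] at hn
    rw [hσn, hn, mul_zero]

theorem MonomiallyTransitive.isNeighbourTransitive [DivisionRing F] [DecidableEq F] [Fintype N]
    {C : AddSubgroup (N → F)} {r : ℕ} (hC : MonomiallyTransitive r (C : Set (N → F))) (hr : 1 ≤ r)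
    (hrN : r ≤ Fintype.card N) (hmin : ∀ c ∈ C, c ≠ 0 → 2 * r ≤ hammingNorm c) :
    IsNeighbourTransitive r (C : Set (N → F)) :=
  isNeighbourTransitive_of_two_mul_le_hammingNorm hr hrN hmin fun _ hi _ _ hw hw' =>
    (hC.mono hi (by rwa [Nat.card_eq_fintype_card])).exists_mem_codeAut_apply_eq hw hw'

end MonomialMaps

section LinearAlgebra

variable {ι K V : Type*} [Finite ι] [Field K] [AddCommGroup V] [Module K V] {v w : ι → V}

theorem exists_linearEquiv_apply_eq (hv : LinearIndependent K v) (hw : LinearIndependent K w) :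
    ∃ g : V ≃ₗ[K] V, ∀ i, g (v i) = w i := by
  have : FiniteDimensional K (Submodule.span K (Set.range v)) :=
    FiniteDimensional.span_of_finite K (Set.finite_range v)
  obtain ⟨g, hg⟩ := Submodule.exists_linearEquiv_restrict_eq
    (hv.linearCombinationEquiv.symm ≪≫ₗ hw.linearCombinationEquiv)
  refine ⟨g, fun i => ?_⟩
  simpa using (hg (hv.linearCombinationEquiv (Finsupp.single i 1))).symm

theorem exists_affineEquiv_apply_eq (hv : AffineIndependent K v) (hw : AffineIndependent K w) :
    ∃ e : V ≃ᵃ[K] V, ∀ i, e (v i) = w i := by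
  rcases isEmpty_or_nonempty ι with _ | ⟨⟨j⟩⟩
  · exact ⟨.refl K V, isEmptyElim⟩
  rw [affineIndependent_iff_linearIndependent_vsub K _ j] at hv hw
  obtain ⟨g, hg⟩ := exists_linearEquiv_apply_eq hv hw
  refine ⟨(AffineEquiv.vaddConst K (v j)).symm.trans
    (g.toAffineEquiv.trans (AffineEquiv.vaddConst K (w j))), fun i => ?_⟩
  rcases eq_or_ne i j with rfl | hij
  · simp
  · have hgi := hg ⟨i, hij⟩
    simp only [vsub_eq_sub] at hgi
    simp [hgi]

end LinearAlgebra

open MvPolynomial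

section Polynomials

variable {σ τ R K : Type*}

theorem eval_aeval [CommSemiring R] (g : σ → MvPolynomial τ R) (v : τ → R) (f : MvPolynomial σ R) :
    eval v (aeval g f) = eval (fun i => eval v (g i)) f :=
  eval₂Hom_bind₁ _ _ _ _

theorem totalDegree_aeval_le [CommSemiring R] {g : σ → MvPolynomial τ R} {d : ℕ}
    (hg : ∀ i, (g i).totalDegree ≤ d) (f : MvPolynomial σ R) :
    (aeval g f).totalDegree ≤ f.totalDegree * d := by
  rw [aeval_def, eval₂_eq]
  refine totalDegree_finsetSum_le fun m hm => ?_
  calc (C (coeff m f) * ∏ i ∈ m.support, g i ^ m i).totalDegree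
      ≤ ∑ i ∈ m.support, (g i ^ m i).totalDegree :=
        (totalDegree_mul _ _).trans <| by
          simpa only [totalDegree_C, zero_add] using totalDegree_finsetProd _ _
    _ ≤ ∑ i ∈ m.support, m i * d :=
      Finset.sum_le_sum fun i _ => (totalDegree_pow _ _).trans (Nat.mul_le_mul_left _ (hg i))
    _ ≤ f.totalDegree * d := by
      rw [← Finset.sum_mul]
      exact Nat.mul_le_mul_right d (le_totalDegree hm)

theorem totalDegree_prod_le_card_mul [CommSemiring R] {ι : Type*} {T : Finset ι}
    {L : ι → MvPolynomial σ R} {d : ℕ} (hL : ∀ i ∈ T, (L i).totalDegree ≤ d) :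
    (∏ i ∈ T, L i).totalDegree ≤ T.card * d :=
  (totalDegree_finsetProd _ _).trans (Finset.sum_le_card_nsmul _ _ _ hL)

theorem exists_totalDegree_le_card [CommSemiring R] [NoZeroDivisors R] [Nontrivial R] {ι : Type*}
    (T : Finset ι) {Z : ι → Set (σ → R)} {p : σ → R}
    (h : ∀ i ∈ T, ∃ L : MvPolynomial σ R,
      L.totalDegree ≤ 1 ∧ eval p L ≠ 0 ∧ ∀ x ∈ Z i, eval x L = 0) :
    ∃ g : MvPolynomial σ R,
      g.totalDegree ≤ T.card ∧ eval p g ≠ 0 ∧ ∀ i ∈ T, ∀ x ∈ Z i, eval x g = 0 := by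
  choose! L hdeg hp hZ using h
  refine ⟨∏ i ∈ T, L i, ?_, ?_, fun i hi x hx => ?_⟩
  · simpa using totalDegree_prod_le_card_mul hdeg
  · simpa [eval_prod, Finset.prod_eq_zero_iff] using hp
  · rw [eval_prod, Finset.prod_eq_zero hi (hZ i hi x hx)]

theorem exists_totalDegree_le_one_of_ne [CommRing R] {p r : σ → R} (h : p ≠ r) :
    ∃ L : MvPolynomial σ R, L.totalDegree ≤ 1 ∧ eval p L ≠ 0 ∧ eval r L = 0 := by
  obtain ⟨i, hi⟩ := Function.ne_iff.1 h
  have : Nontrivial R := ⟨_, _, hi⟩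
  exact ⟨X i - C (r i), (totalDegree_sub_C_le _ _).trans (totalDegree_X _).le,
    by simpa [sub_eq_zero] using hi, by simp⟩

variable [Field K]

theorem exists_totalDegree_le_one_of_notMem [Finite σ] {p : σ → K} {W : Submodule K (σ → K)}
    (h : p ∉ W) :
    ∃ L : MvPolynomial σ K, L.totalDegree ≤ 1 ∧ eval p L ≠ 0 ∧ ∀ x ∈ W, eval x L = 0 := by
  classical
  have := Fintype.ofFinite σ
  obtain ⟨φ, hφ, hle⟩ := Submodule.exists_le_ker_of_notMem h
  let M := LinearMap.toMatrix' (LinearMap.pi fun _ : Unit => φ)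
  have hM (x) : eval x (M.toMvPolynomial ()) = φ x := by
    rw [Matrix.toMvPolynomial_eval_eq_apply, LinearMap.toMatrix'_mulVec, LinearMap.pi_apply]
  refine ⟨M.toMvPolynomial (), M.toMvPolynomial_totalDegree_le (), ?_, fun x hx => ?_⟩
  · rwa [hM]
  · rw [hM]
    exact hle hx

variable [Fintype K]

theorem exists_totalDegree_add_two_le_card_of_ne_zero {p : σ → K} (hp : p ≠ 0) :
    ∃ g : MvPolynomial σ K, g.totalDegree + 2 ≤ Fintype.card K ∧ eval p g ≠ 0 ∧
      ∀ a : K, a ≠ 0 → a ≠ 1 → eval (a • p) g = 0 := by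
  classical
  let T : Finset K := {0, 1}ᶜ
  have hT : T.card + 2 = Fintype.card K := by
    rw [← Finset.card_pair (zero_ne_one (α := K)), Finset.card_compl_add_card]
  obtain ⟨g, hdeg, hgp, hg⟩ := exists_totalDegree_le_card T (Z := fun a => {a • p}) (p := p)
    fun a ha => by
      have hne : p ≠ a • p := by
        intro h
        have h1 := smul_left_injective K hp ((one_smul K p).trans h)
        simp [T, ← h1] at ha
      simpa using exists_totalDegree_le_one_of_ne hne
  exact ⟨g, by omega, hgp, fun a h0 h1 => hg a (by simp [T, h0, h1]) _ rfl⟩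

variable [Fintype σ]

theorem card_sub_one_mul_card_le_totalDegree {h : MvPolynomial σ K} {p : σ → K}
    (hp : eval p h ≠ 0) (hx : ∀ x, x ≠ p → eval x h = 0) :
    (Fintype.card K - 1) * Fintype.card σ ≤ h.totalDegree := by
  classical
  by_contra! hlt
  have hsum := sum_eval_eq_zero h hlt
  rw [Finset.sum_eq_single p (fun x _ => hx x) (by simp)] at hsum
  exact hp hsum

theorem card_sub_one_mul_card_lt_totalDegree_add_hammingNorm [DecidableEq K] [DecidableEq σ]
    {f : MvPolynomial σ K} (hf : (fun x => eval x f) ≠ 0) :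
    (Fintype.card K - 1) * Fintype.card σ <
      f.totalDegree + hammingNorm fun x : σ → K => eval x f := by
  obtain ⟨p, hp⟩ := Function.ne_iff.1 hf
  let T := (Finset.univ.filter fun x => eval x f ≠ 0).erase p
  have hT : T.card + 1 = hammingNorm fun x : σ → K => eval x f :=
    Finset.card_erase_add_one (by simpa using hp)
  obtain ⟨g, hdeg, hgp, hg⟩ := exists_totalDegree_le_card T (Z := fun r => {r}) (p := p)
    fun r hr => by
      simpa using exists_totalDegree_le_one_of_ne (Finset.ne_of_mem_erase hr).symm
  have hle : (Fintype.card K - 1) * Fintype.card σ ≤ (f * g).totalDegree := by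
    refine card_sub_one_mul_card_le_totalDegree (p := p) ?_ fun x hx => ?_
    · rw [map_mul]
      exact mul_ne_zero hp hgp
    · rw [map_mul]
      by_cases hfx : eval x f = 0
      · rw [hfx, zero_mul]
      · rw [hg x (by simp [T, hx, hfx]) x rfl, mul_zero]
  have hmul := totalDegree_mul f g
  omega

end Polynomials

section Affine

variable {F E : Type*} [Field F] [Field E] [Algebra F E] {ℓ t : ℕ}

theorem subfieldRM_self : subfieldRM F F ℓ t = RM F ℓ t := rfl

theorem subsingleton_units_of_card_eq_two (hF : Nat.card F = 2) : Subsingleton Fˣ :=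
  (Nat.card_eq_one_iff_unique.1 (by rw [Nat.card_units, hF])).1

theorem cast_hammingNorm_eq_sum {ι : Type*} [Fintype ι] [DecidableEq F] [Subsingleton Fˣ]
    (c : ι → F) : (hammingNorm c : F) = ∑ x, c x := by
  rw [hammingNorm, Finset.card_filter, Nat.cast_sum]
  refine Finset.sum_congr rfl fun x _ => ?_
  split_ifs with hx
  · rw [Nat.cast_one, ← Units.val_mk0 hx, Subsingleton.elim (Units.mk0 (c x) hx) 1, Units.val_one]
  · rw [not_not.1 hx, Nat.cast_zero]

theorem card_sub_one_mul_lt_add_hammingNorm_of_mem_subfieldRM [Fintype E] [DecidableEq F]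
    {c : (Fin t → E) → F} (hc : c ∈ subfieldRM F E ℓ t) (h0 : c ≠ 0) :
    (Fintype.card E - 1) * t < ℓ + hammingNorm c := by
  classical
  obtain ⟨f, hf, hcf⟩ := hc
  have hcf' : (fun v => algebraMap F E (c v)) = fun v => eval v f := funext hcf
  have hnorm : hammingNorm (fun v => algebraMap F E (c v)) = hammingNorm c :=
    hammingNorm_comp _ (fun _ => (algebraMap F E).injective) fun _ => map_zero _
  have hlt := card_sub_one_mul_card_lt_totalDegree_add_hammingNorm (f := f) <| by
    rwa [← hcf', ← hammingNorm_ne_zero_iff, hnorm, hammingNorm_ne_zero_iff]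
  rw [← hcf', hnorm, Fintype.card_fin] at hlt
  omega

theorem sum_eq_zero_of_mem_subfieldRM [Fintype E] (hℓ : ℓ < (Fintype.card E - 1) * t)
    {c : (Fin t → E) → F} (hc : c ∈ subfieldRM F E ℓ t) : ∑ v, c v = 0 := by
  obtain ⟨f, hf, hcf⟩ := hc
  apply (algebraMap F E).injective
  rw [map_sum, map_zero, Fintype.sum_congr _ _ hcf]
  exact sum_eval_eq_zero f (by rw [Fintype.card_fin]; exact hf.trans_lt hℓ)

theorem even_hammingNorm_of_mem_subfieldRM [Fintype E] [DecidableEq F] (hF : Nat.card F = 2)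
    (hℓ : ℓ < (Fintype.card E - 1) * t) {c : (Fin t → E) → F} (hc : c ∈ subfieldRM F E ℓ t) :
    Even (hammingNorm c) := by
  have : Finite F := Nat.finite_of_card_ne_zero (by omega)
  have := Fintype.ofFinite F
  have := subsingleton_units_of_card_eq_two hF
  have : Fact (Nat.Prime 2) := ⟨Nat.prime_two⟩
  have : CharP F 2 := charP_of_card_eq_prime (by rwa [← Nat.card_eq_fintype_card])
  rw [even_iff_two_dvd, ← CharP.cast_eq_zero_iff F 2, cast_hammingNorm_eq_sum]
  exact sum_eq_zero_of_mem_subfieldRM hℓ hc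

theorem comp_affineMap_mem_RM {t' : ℕ} {c : (Fin t → F) → F} (hc : c ∈ RM F ℓ t)
    (A : (Fin t' → F) →ᵃ[F] (Fin t → F)) : c ∘ A ∈ RM F ℓ t' := by
  obtain ⟨f, hf, hcf⟩ := hc
  let g (i : Fin t) := (LinearMap.toMatrix' A.linear).toMvPolynomial i + C (A 0 i)
  have hg (i) : (g i).totalDegree ≤ 1 :=
    (totalDegree_add _ _).trans (max_le (Matrix.toMvPolynomial_totalDegree_le _ i) (by simp))
  have hgA (v) : (fun i => eval v (g i)) = A v := by
    rw [AffineMap.decomp A]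
    ext i
    simp [g, Matrix.toMvPolynomial_eval_eq_apply]
  refine ⟨aeval g f, ?_, fun v => ?_⟩
  · exact ((totalDegree_aeval_le hg f).trans (mul_one _).le).trans hf
  · rw [eval_aeval, hgA, ← hcf, Function.comp_apply]

theorem monomialMap_affineEquiv_mem_codeAut_subfieldRM [Finite F] [Finite E]
    (e : (Fin t → E) ≃ᵃ[E] (Fin t → E)) :
    monomialMap e.toEquiv 1 ∈ codeAut (subfieldRM F E ℓ t : Set ((Fin t → E) → F)) := by
  refine mem_codeAut_of_forall_mem fun c hc => ?_
  have hce : monomialMap e.toEquiv 1 c = c ∘ e := by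
    ext v
    simp
  rw [hce]
  exact comp_affineMap_mem_RM hc e.toAffineMap

theorem monomiallyTransitive_two_subfieldRM [Finite E] (hF : Nat.card F = 2) :
    MonomiallyTransitive 2 (subfieldRM F E ℓ t : Set ((Fin t → E) → F)) := by
  have : Finite F := Nat.finite_of_card_ne_zero (by omega)
  have := subsingleton_units_of_card_eq_two hF
  have hindep (x : Fin 2 ↪ (Fin t → E)) : AffineIndependent E x := by
    convert affineIndependent_of_ne E (x.injective.ne zero_ne_one)
    ext i : 1
    fin_cases i <;> rfl
  intro x y a
  obtain ⟨e, he⟩ := exists_affineEquiv_apply_eq (hindep y) (hindep x)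
  exact ⟨e.toEquiv, 1, monomialMap_affineEquiv_mem_codeAut_subfieldRM e,
    fun i => ⟨he i, Subsingleton.elim _ _⟩⟩

theorem isNeighbourTransitive_two_subfieldRM [Finite E] (hF : Nat.card F = 2)
    (hℓ : (ℓ : ℤ) ≤ ((t : ℤ) - 1) * ((Nat.card E : ℤ) - 1) - 1) :
    IsNeighbourTransitive 2 (subfieldRM F E ℓ t : Set ((Fin t → E) → F)) := by
  classical
  have := Fintype.ofFinite E
  rw [Nat.card_eq_fintype_card] at hℓ
  have hE : 1 < Fintype.card E := Fintype.one_lt_card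
  have hdeg : ℓ + Fintype.card E ≤ (Fintype.card E - 1) * t := by
    zify [hE.le]
    linarith
  have : Nonempty (Fin t) := Fin.pos_iff_nonempty.1 <| Nat.pos_of_ne_zero <| by
    rintro rfl
    omega
  refine MonomiallyTransitive.isNeighbourTransitive (C := (subfieldRM F E ℓ t).toAddSubgroup)
    (monomiallyTransitive_two_subfieldRM hF) one_le_two Fintype.one_lt_card fun c hc h0 => ?_
  have hlt := card_sub_one_mul_lt_add_hammingNorm_of_mem_subfieldRM hc h0
  obtain ⟨m, hm⟩ := even_hammingNorm_of_mem_subfieldRM hF (by omega) hc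
  omega

end Affine

section Projective

variable {F E : Type*} [Field F] [Field E] [Algebra F E] {t k ℓ : ℕ} {S : Set (Fin t → E)}

theorem eval_smul_of_mem_polyR {f : MvPolynomial (Fin t) E} (hf : f ∈ polyR F E t k) (a : E)
    (v : Fin t → E) : eval (a • v) f = algebraMap F E (Algebra.norm F a) ^ k * eval v f := by
  have h := congrArg (eval v) (hf.2 a)
  rw [eval_aeval] at h
  simpa [Pi.smul_def] using h

theorem eval_zero_of_mem_polyR [Module.Finite F E] (hk : 0 < k) {f : MvPolynomial (Fin t) E}
    (hf : f ∈ polyR F E t k) : eval 0 f = 0 := by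
  have h := eval_smul_of_mem_polyR hf 0 0
  rwa [zero_smul, Algebra.norm_zero, map_zero, zero_pow hk.ne', zero_mul] at h

theorem aeval_toMvPolynomial_mem_polyR {t' : ℕ} {f : MvPolynomial (Fin t) E}
    (hf : f ∈ polyR F E t k) (M : Matrix (Fin t) (Fin t') E) :
    aeval M.toMvPolynomial f ∈ polyR F E t' k := by
  refine ⟨fun v => by rw [eval_aeval]; exact hf.1 _, fun a => ?_⟩
  have hcomm (i) : aeval (fun j => C a * X j) (M.toMvPolynomial i) =
      aeval M.toMvPolynomial (C a * X i : MvPolynomial (Fin t) E) := by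
    simp only [Matrix.toMvPolynomial, ← C_mul_X_eq_monomial, map_sum, map_mul, aeval_X,
      ← algebraMap_eq, AlgHom.commutes, Finset.mul_sum]
    exact Finset.sum_congr rfl fun j _ => mul_left_comm _ _ _
  simp only [comp_aeval_apply, hcomm]
  rw [← comp_aeval_apply, hf.2 a, map_mul, aeval_C, algebraMap_eq]

theorem IsProjectiveReps.ne_zero (hS : IsProjectiveReps S) {v : Fin t → E} (hv : v ∈ S) :
    v ≠ 0 := by
  rintro rfl
  have h : Module.finrank E (Submodule.span E {(0 : Fin t → E)}) = 1 := hS.mapsTo hv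
  rw [Submodule.span_zero_singleton, finrank_bot] at h
  exact zero_ne_one h

theorem IsProjectiveReps.exists_eq_smul (hS : IsProjectiveReps S) {x : Fin t → E} (hx : x ≠ 0) :
    ∃ (v : S) (a : Eˣ), x = a • (v : Fin t → E) := by
  obtain ⟨v, hv, h⟩ := hS.surjOn (finrank_span_singleton (K := E) hx)
  dsimp only at h
  have hmem : x ∈ Submodule.span E {v} := h ▸ Submodule.mem_span_singleton_self x
  obtain ⟨a, rfl⟩ := Submodule.mem_span_singleton.1 hmem
  exact ⟨⟨v, hv⟩, Units.mk0 a (left_ne_zero_of_smul hx), rfl⟩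

theorem IsProjectiveReps.eq_of_smul_eq_smul (hS : IsProjectiveReps S) {v w : S} {a b : Eˣ}
    (h : a • (v : Fin t → E) = b • (w : Fin t → E)) : v = w ∧ a = b := by
  obtain rfl : v = w := by
    refine Subtype.ext (hS.injOn v.2 w.2 ?_)
    rw [← Submodule.span_singleton_group_smul_eq E a, h, Submodule.span_singleton_group_smul_eq]
  exact ⟨rfl, Units.ext (smul_left_injective E (hS.ne_zero v.2) h)⟩

theorem IsProjectiveReps.notMem_span_singleton (hS : IsProjectiveReps S) {v w : S} (hvw : v ≠ w) :
    (v : Fin t → E) ∉ Submodule.span E {(w : Fin t → E)} := by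
  intro h
  obtain ⟨a, ha⟩ := Submodule.mem_span_singleton.1 h
  have ha0 : a ≠ 0 := left_ne_zero_of_smul (ha ▸ hS.ne_zero v.2)
  exact hvw (hS.eq_of_smul_eq_smul (a := 1) (b := Units.mk0 a ha0)
    ((one_smul _ _).trans ha.symm)).1

theorem IsProjectiveReps.linearIndependent (hS : IsProjectiveReps S) (x : Fin 2 ↪ S) :
    LinearIndependent E fun i => (x i : Fin t → E) := by
  refine linearIndependent_fin2.2 ⟨hS.ne_zero (x 1).2, fun a ha => ?_⟩
  exact hS.notMem_span_singleton (x.injective.ne zero_ne_one)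
    (Submodule.mem_span_singleton.2 ⟨a, ha⟩)

theorem IsProjectiveReps.nontrivial (hS : IsProjectiveReps S) (ht : 1 < t) : Nontrivial S := by
  by_contra h
  rw [not_nontrivial_iff_subsingleton] at h
  have : Nonempty (Fin t) := ⟨⟨0, by omega⟩⟩
  obtain ⟨x, hx⟩ := exists_ne (0 : Fin t → E)
  obtain ⟨v, -, -⟩ := hS.exists_eq_smul hx
  have hspan (y : Fin t → E) : ∃ a : E, a • (v : Fin t → E) = y := by
    rcases eq_or_ne y 0 with rfl | hy
    · exact ⟨0, zero_smul _ _⟩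
    · obtain ⟨w, a, rfl⟩ := hS.exists_eq_smul hy
      exact ⟨a, by rw [Subsingleton.elim v w, Units.smul_def]⟩
  have hrank := finrank_le_one _ hspan
  rw [Module.finrank_fin_fun] at hrank
  omega

theorem IsProjectiveReps.exists_perm [Finite E] (hS : IsProjectiveReps S)
    (g : (Fin t → E) ≃ₗ[E] (Fin t → E)) :
    ∃ (σ : Equiv.Perm S) (μ : S → Eˣ), ∀ v : S, g v = μ v • (σ v : Fin t → E) := by
  choose σ μ hσμ using fun v : S => hS.exists_eq_smul (g.map_ne_zero_iff.2 (hS.ne_zero v.2))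
  have hinj : Function.Injective σ := fun v w hvw => by
    have h : (μ v)⁻¹ • (v : Fin t → E) = (μ w)⁻¹ • (w : Fin t → E) := by
      apply g.injective
      simp only [Units.smul_def, map_smul]
      simp only [← Units.smul_def, hσμ, hvw, inv_smul_smul]
    exact (hS.eq_of_smul_eq_smul h).1
  exact ⟨Equiv.ofBijective σ (Finite.injective_iff_bijective.1 hinj), μ, hσμ⟩

theorem IsProjectiveReps.exists_eval_ne_zero_forall_eval_smul_eq_zero [Fintype E]
    (hS : IsProjectiveReps S) {T : Finset S} {p : S} (hp : p ∈ T) :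
    ∃ g : MvPolynomial (Fin t) E, g.totalDegree + 3 ≤ Fintype.card E + T.card ∧ eval p g ≠ 0 ∧
      ∀ v ∈ T, ∀ a : Eˣ, a • (v : Fin t → E) ≠ p → eval (a • (v : Fin t → E)) g = 0 := by
  classical
  obtain ⟨g₁, hdeg₁, hp₁, hg₁⟩ := exists_totalDegree_add_two_le_card_of_ne_zero (hS.ne_zero p.2)
  obtain ⟨g₂, hdeg₂, hp₂, hg₂⟩ := exists_totalDegree_le_card (T.erase p)
    (Z := fun v => (Submodule.span E {(v : Fin t → E)} : Set (Fin t → E))) (p := p) fun v hv =>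
      exists_totalDegree_le_one_of_notMem
        (hS.notMem_span_singleton (Finset.ne_of_mem_erase hv).symm)
  refine ⟨g₁ * g₂, ?_, ?_, fun v hv a hav => ?_⟩
  · have hmul := totalDegree_mul g₁ g₂
    have hT := Finset.card_erase_add_one hp
    omega
  · rw [map_mul]
    exact mul_ne_zero hp₁ hp₂
  · rw [map_mul, mul_eq_zero]
    rcases eq_or_ne v p with rfl | hvp
    · exact .inl (hg₁ a a.ne_zero fun ha => hav (by rw [Units.smul_def, ha, one_smul]))
    · exact .inr (hg₂ v (Finset.mem_erase.2 ⟨hvp, hv⟩) _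
        (Submodule.smul_mem _ (a : E) (Submodule.mem_span_singleton_self _)))

theorem card_sub_one_mul_add_two_le_of_mem_subfieldPRM [Fintype E] [DecidableEq F] [Fintype S]
    (hS : IsProjectiveReps S) (hk : 0 < k) {c : S → F} (hc : c ∈ subfieldPRM F E k ℓ t S)
    (h0 : c ≠ 0) :
    (Fintype.card E - 1) * t + 2 ≤ ℓ + (Fintype.card E - 1) + hammingNorm c := by
  obtain ⟨f, hfR, hf, hcf⟩ := hc
  obtain ⟨p, hp⟩ := Function.ne_iff.1 h0
  obtain ⟨g, hdeg, hgp, hg⟩ := hS.exists_eval_ne_zero_forall_eval_smul_eq_zero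
    (T := Finset.univ.filter fun v => c v ≠ 0) (p := p) (by simpa using hp)
  have hle := card_sub_one_mul_card_le_totalDegree (h := f * g) (p := p)
    (by simpa [← hcf] using ⟨hp, hgp⟩) fun x hxp => by
      rw [map_mul, mul_eq_zero]
      rcases eq_or_ne x 0 with rfl | hx0
      · exact .inl (eval_zero_of_mem_polyR hk hfR)
      obtain ⟨v, a, rfl⟩ := hS.exists_eq_smul hx0
      by_cases hcv : c v = 0
      · exact .inl (by
          rw [Units.smul_def, eval_smul_of_mem_polyR hfR, ← hcf, hcv, map_zero, mul_zero])
      · exact .inr (hg v (by simpa using hcv) a hxp)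
  rw [Fintype.card_fin] at hle
  have hmul := totalDegree_mul f g
  rw [hammingNorm]
  omega

theorem exists_norm_pow_eq [Finite E] (hk : Nat.gcd k (Nat.card F - 1) = 1) (a : Fˣ) :
    ∃ b : Eˣ, Units.map (Algebra.norm F (S := E)) b ^ k = a := by
  have : Finite F := Finite.of_injective _ (algebraMap F E).injective
  have hcop : (Nat.card Fˣ).Coprime k := by
    rw [Nat.card_units, Nat.coprime_comm]
    exact hk
  obtain ⟨c, rfl⟩ := (powCoprime hcop).surjective a
  obtain ⟨b, rfl⟩ := FiniteField.unitsMap_norm_surjective F E c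
  exact ⟨b, rfl⟩

theorem monomialMap_mem_codeAut_subfieldPRM [Finite F] [Finite S]
    {g : (Fin t → E) →ₗ[E] (Fin t → E)} {σ : Equiv.Perm S} {μ : S → Eˣ}
    (hg : ∀ v : S, g v = μ v • (σ v : Fin t → E)) :
    monomialMap σ (fun v => Units.map (Algebra.norm F) (μ v) ^ k) ∈
      codeAut (subfieldPRM F E k ℓ t S : Set (S → F)) := by
  refine mem_codeAut_of_forall_mem fun c ⟨f, hfR, hf, hcf⟩ => ?_
  let M := LinearMap.toMatrix' g
  have hM (x) : (fun i => eval x (M.toMvPolynomial i)) = g x := by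
    ext i
    rw [Matrix.toMvPolynomial_eval_eq_apply, LinearMap.toMatrix'_mulVec]
  have hdeg := totalDegree_aeval_le (Matrix.toMvPolynomial_totalDegree_le M) f
  refine ⟨aeval M.toMvPolynomial f, aeval_toMvPolynomial_mem_polyR hfR M,
    (hdeg.trans (mul_one _).le).trans hf, fun v => ?_⟩
  rw [eval_aeval, hM, hg, Units.smul_def, eval_smul_of_mem_polyR hfR, ← hcf]
  simp

theorem monomiallyTransitive_two_subfieldPRM [Finite E] (hS : IsProjectiveReps S)
    (hk : Nat.gcd k (Nat.card F - 1) = 1) :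
    MonomiallyTransitive 2 (subfieldPRM F E k ℓ t S : Set (S → F)) := by
  have : Finite F := Finite.of_injective _ (algebraMap F E).injective
  intro x y a
  choose b hb using fun i => exists_norm_pow_eq (E := E) hk (a i)
  obtain ⟨g, hg⟩ := exists_linearEquiv_apply_eq (hS.linearIndependent y)
    ((hS.linearIndependent x).units_smul b)
  obtain ⟨σ, μ, hσμ⟩ := hS.exists_perm g
  refine ⟨σ, _, monomialMap_mem_codeAut_subfieldPRM (g := g.toLinearMap) hσμ, fun i => ?_⟩
  obtain ⟨hσ, hμ⟩ := hS.eq_of_smul_eq_smul ((hσμ (y i)).symm.trans (hg i))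
  exact ⟨hσ, by rw [hμ, hb]⟩

theorem isNeighbourTransitive_two_subfieldPRM [Finite E] (hS : IsProjectiveReps S) (hk : 0 < k)
    (hgcd : Nat.gcd k (Nat.card F - 1) = 1)
    (hℓ : (ℓ : ℤ) ≤ ((t : ℤ) - 1) * ((Nat.card E : ℤ) - 1) - 2) :
    IsNeighbourTransitive 2 (subfieldPRM F E k ℓ t S : Set (S → F)) := by
  classical
  have := Fintype.ofFinite E
  have := Fintype.ofFinite S
  rw [Nat.card_eq_fintype_card] at hℓ
  have hE : 1 < Fintype.card E := Fintype.one_lt_card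
  have hdeg : ℓ + 2 + (Fintype.card E - 1) ≤ (Fintype.card E - 1) * t := by
    zify [hE.le]
    linarith
  have ht : 1 < t := by
    by_contra! ht
    have := Nat.mul_le_mul_left (Fintype.card E - 1) ht
    omega
  have := hS.nontrivial ht
  refine MonomiallyTransitive.isNeighbourTransitive
    (C := (subfieldPRM F E k ℓ t S).toAddSubgroup)
    (monomiallyTransitive_two_subfieldPRM hS hgcd) one_le_two Fintype.one_lt_card fun c hc h0 => ?_
  have hle := card_sub_one_mul_add_two_le_of_mem_subfieldPRM hS hk hc h0
  omega

end Projective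

end NTCodes

theorem proposition5p2_general (F E : Type*) [Field F] [Field E] [Finite E] [Algebra F E]
    (q s t k ℓ : ℕ) (hF : Nat.card F = q) (hE : Nat.card E = q ^ s) (hk : 0 < k) :
    (q = 2 → (ℓ : ℤ) ≤ (t : ℤ) - 2 →
      NTCodes.IsNeighbourTransitive 2 (NTCodes.RM F ℓ t : Set ((Fin t → F) → F))) ∧
    (q = 2 → (ℓ : ℤ) ≤ ((t : ℤ) - 1) * (2 ^ s - 1) - 1 →
      NTCodes.IsNeighbourTransitive 2 (NTCodes.subfieldRM F E ℓ t : Set ((Fin t → E) → F))) ∧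
    ((ℓ : ℤ) ≤ ((t : ℤ) - 1) * ((q : ℤ) - 1) - 2 → Nat.gcd k (q - 1) = 1 →
      ∀ S : Set (Fin t → F), NTCodes.IsProjectiveReps S →
        NTCodes.IsNeighbourTransitive 2 (NTCodes.PRM F k ℓ t S : Set (S → F))) ∧
    ((ℓ : ℤ) ≤ ((t : ℤ) - 1) * ((q : ℤ) ^ s - 1) - 2 → Nat.gcd k (q - 1) = 1 →
      ∀ S : Set (Fin t → E), NTCodes.IsProjectiveReps S →
        NTCodes.IsNeighbourTransitive 2 (NTCodes.subfieldPRM F E k ℓ t S : Set (S → F))) := by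
  have : Finite F := Finite.of_injective _ (algebraMap F E).injective
  subst hF
  refine ⟨fun hq hℓ => ?_, fun hq hℓ => ?_, fun hℓ hgcd S hS => ?_, fun hℓ hgcd S hS => ?_⟩
  · rw [← NTCodes.subfieldRM_self]
    exact NTCodes.isNeighbourTransitive_two_subfieldRM hq (by rw [hq]; push_cast; linarith)
  · exact NTCodes.isNeighbourTransitive_two_subfieldRM hq (by rw [hE, hq]; exact_mod_cast hℓ)
  · exact NTCodes.isNeighbourTransitive_two_subfieldPRM hS hk hgcd hℓ
  · exact NTCodes.isNeighbourTransitive_two_subfieldPRM hS hk hgcd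
      (by rw [hE]; exact_mod_cast hℓ)

theorem proposition5p2 (F E : Type*) [Field F] [Finite F] [Field E] [Finite E] [Algebra F E]
    (q s t k ℓ : ℕ) (hs : 0 < s) (hF : Nat.card F = q) (hE : Nat.card E = q ^ s)
    (hk : 0 < k) (hkq : k ≤ q - 1) :
    (q = 2 → (ℓ : ℤ) ≤ (t : ℤ) - 2 →
      NTCodes.IsNeighbourTransitive 2 (NTCodes.RM F ℓ t : Set ((Fin t → F) → F))) ∧
    (q = 2 → (ℓ : ℤ) ≤ ((t : ℤ) - 1) * (2 ^ s - 1) - 1 →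
      NTCodes.IsNeighbourTransitive 2 (NTCodes.subfieldRM F E ℓ t : Set ((Fin t → E) → F))) ∧
    ((ℓ : ℤ) ≤ ((t : ℤ) - 1) * ((q : ℤ) - 1) - 2 → Nat.gcd k (q - 1) = 1 →
      ∀ S : Set (Fin t → F), NTCodes.IsProjectiveReps S →
        NTCodes.IsNeighbourTransitive 2 (NTCodes.PRM F k ℓ t S : Set (S → F))) ∧
    ((ℓ : ℤ) ≤ ((t : ℤ) - 1) * ((q : ℤ) ^ s - 1) - 2 → Nat.gcd k (q - 1) = 1 →
      ∀ S : Set (Fin t → E), NTCodes.IsProjectiveReps S →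
        NTCodes.IsNeighbourTransitive 2 (NTCodes.subfieldPRM F E k ℓ t S : Set (S → F))) :=
  proposition5p2_general F E q s t k ℓ hF hE hk
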